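/- For $n\ge 0$, a $B_n$-partition is a partition $\pi$ of the set $\{1,2,\dots,n,-1,-2,\dots,-n\}$ such that for every block $B$ of $\pi$ the set $-B=\{-b : b\in B\}$ is also a block of $\pi$, and such that at most one block $B$, called the zero-block, satisfies $B=-B$. A block pair of $\pi$ is an unordered pair $\{B,-B\}$, where $B$ is a block of $\pi$ with $B\neq -B$. Let $\xi_n'$ be the number of block pairs of a $B_n$-partition chosen uniformly at random among all $B_n$-partitions that have no zero-block, and let $E(\xi_n')$ and $V(\xi_n')$ be its expectation and variance. **Theorem.** The limiting distribution of $\xi_n'$ is normal: as $n\to\infty$, the random variable $$\frac{\xi_n'-E(\xi_n')}{\sqrt{V(\xi_n')}}$$ converges in distribution to the standard normal distribution $N(0,1)$. (The quotient is read as $0$ for the finitely many $n$ with $V(\xi_n')=0$.) -/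

import Mathlib

open MeasureTheory ProbabilityTheory Filter
open scoped Pointwise

/-- The set `{1, …, n, -1, …, -n}`. -/
noncomputable def signedSet (n : ℕ) : Finset ℤ := (Finset.Icc (-(n : ℤ)) n).erase 0

/-- A block `B` is a zero-block if `B = -B`, where `-B = {-b | b ∈ B}`. -/
def IsZeroBlock (B : Finset ℤ) : Prop := B = -B

instance (B : Finset ℤ) : Decidable (IsZeroBlock B) :=
  inferInstanceAs (Decidable (B = -B))

/-- A partition of `{±1, …, ±n}` is of type `B_n` if the negative of each block is a block and
there is at most one zero-block. -/
structure IsTypeB {n : ℕ} (π : Finpartition (signedSet n)) : Prop where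
  neg_mem : ∀ B ∈ π.parts, -B ∈ π.parts
  zeroBlock_unique : ∀ B ∈ π.parts, ∀ C ∈ π.parts, IsZeroBlock B → IsZeroBlock C → B = C

/-- The set of `B_n`-partitions without zero-block. -/
def BPartitionNoZero (n : ℕ) : Type :=
  {π : Finpartition (signedSet n) // IsTypeB π ∧ ∀ B ∈ π.parts, ¬ IsZeroBlock B}

/-- The set of block pairs of a partition: the unordered pairs `{B, -B}` where `B` is a block that
is not a zero-block. -/
def blockPairs {n : ℕ} (π : Finpartition (signedSet n)) : Finset (Sym2 (Finset ℤ)) :=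
  (π.parts.filter fun B => ¬ IsZeroBlock B).image fun B => s(B, -B)

instance (n : ℕ) : Finite (BPartitionNoZero n) :=
  inferInstanceAs (Finite {π : Finpartition (signedSet n) //
    IsTypeB π ∧ ∀ B ∈ π.parts, ¬ IsZeroBlock B})

/-- The partition of `{±1, …, ±n}` into singletons is a `B_n`-partition without zero-block. -/
instance (n : ℕ) : Nonempty (BPartitionNoZero n) := by
  have h : ∀ B ∈ (⊥ : Finpartition (signedSet n)).parts, ¬ IsZeroBlock B := by
    intro B hB hz
    obtain ⟨a, ha, rfl⟩ := Finpartition.mem_bot_iff.1 hB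
    have h0 : a ≠ 0 := (Finset.mem_erase.1 ha).1
    have h1 : ({a} : Finset ℤ) = {-a} := by simpa [IsZeroBlock] using hz
    have h2 : a = -a := Finset.singleton_injective h1
    omega
  refine ⟨⟨⊥, ⟨?_, fun B hB _ _ hz _ => absurd hz (h B hB)⟩, h⟩⟩
  intro B hB
  obtain ⟨a, ha, rfl⟩ := Finpartition.mem_bot_iff.1 hB
  refine Finpartition.mem_bot_iff.2 ⟨-a, ?_, by simp⟩
  simp only [signedSet, Finset.mem_erase, Finset.mem_Icc] at ha ⊢
  omega

/-- Every set of `B_n`-partitions without zero-block is an event. -/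
instance (n : ℕ) : MeasurableSpace (BPartitionNoZero n) := ⊤

instance (n : ℕ) : DiscreteMeasurableSpace (BPartitionNoZero n) :=
  ⟨fun _ => trivial⟩

/-- The uniform distribution on the `B_n`-partitions without zero-block. -/
noncomputable def unifBPartitionNoZero (n : ℕ) : Measure (BPartitionNoZero n) :=
  uniformOn Set.univ

instance (n : ℕ) : IsProbabilityMeasure (unifBPartitionNoZero n) :=
  inferInstanceAs (IsProbabilityMeasure (uniformOn (Set.univ : Set (BPartitionNoZero n))))

/-- The random variable `ξ'_n`: the number of block pairs of a `B_n`-partition without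
zero-block. -/
def numBlockPairs (n : ℕ) (π : BPartitionNoZero n) : ℝ := (blockPairs π.1).card

/-!
A `B_{n+1}`-partition without zero-block arises from a `B_n`-partition with `k` block pairs either
by adding the pair `{n+1}, {-n-1}` or, in `2k` ways, by putting `n+1` into one of the `2k` blocks
and `-n-1` into the opposite one. Hence the generating polynomials satisfy
`pₙ₊₁ = X (pₙ + 2 pₙ')`, so by Hermite–Poulain they have only real roots, and none is positive.
Therefore `ξ'ₙ` is distributed as a sum of independent Bernoulli variables, and asymptotic normality
only needs `V(ξ'ₙ) → ∞`.

For the variance, let `J` have weights proportional to the terms `wⱼ = (2j)ⁿ / (2ʲ j!)` of the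
Dobiński series. The recursion gives `V(J) = V(ξ'ₙ) + 1/2`. Since
`wⱼ² ≤ wⱼ₊₁ ((1 + δ) wⱼ₋₁ + δ wⱼ)` for large `n`, the translation information
`∑ⱼ (wⱼ - wⱼ₊₁)² / wⱼ₊₁` is at most `2δ` times the total mass, and the discrete Cramér–Rao
inequality yields `V(J) ≥ 1 / (2δ)`.
-/

section FinpartitionExt

variable {α : Type*} [DecidableEq α] {s : Finset α}

theorem finpartition_eq_of_parts_subset {π ρ : Finpartition s} (h : π.parts ⊆ ρ.parts) : π = ρ := by
  refine Finpartition.ext (h.antisymm fun B hB => ?_)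
  obtain ⟨x, hx⟩ := ρ.nonempty_of_mem_parts hB
  obtain ⟨C, hC, hxC⟩ := π.exists_mem (ρ.subset hB hx)
  rwa [ρ.eq_of_mem_parts hB (h hC) hx hxC]

theorem finpartition_mem_restrict {π : Finpartition s} {t B : Finset α} (h : t ⊆ s) :
    B ∈ (π.restrict (b := t) h).parts ↔ B ≠ ∅ ∧ ∃ C ∈ π.parts, C ∩ t = B := by
  simp [Finpartition.restrict]

end FinpartitionExt

/-- The partitions of `s` that are stable under `B ↦ -B` and none of whose blocks is its own
negative. For `s = {±1, …, ±n}` these are the `B_n`-partitions without zero-block. -/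
structure IsAntipodal {α : Type*} [DecidableEq α] [Neg α] {s : Finset α}
    (π : Finpartition s) : Prop where
  neg_mem : ∀ B ∈ π.parts, -B ∈ π.parts
  neg_ne : ∀ B ∈ π.parts, -B ≠ B

section Adjoin

variable {α : Type*} [DecidableEq α] [InvolutiveNeg α] {s : Finset α} {a : α} {B C : Finset α}

theorem finset_neg_neg (B : Finset α) : - -B = B := by
  ext
  simp

theorem neg_notMem_of_neg_eq (hs : -s = s) (ha : a ∉ s) : -a ∉ s := by
  rwa [← hs, Finset.mem_neg', neg_neg]

theorem neg_subset_of_subset (hs : -s = s) (hB : B ⊆ s) : -B ⊆ s :=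
  hs ▸ Finset.neg_subset_neg hB

theorem IsAntipodal.disjoint_neg {π : Finpartition s} (hπ : IsAntipodal π) (hB : B ∈ π.parts) :
    Disjoint B (-B) :=
  π.disjoint hB (hπ.neg_mem B hB) (hπ.neg_ne B hB).symm

theorem IsAntipodal.neg_notMem {π : Finpartition s} (hπ : IsAntipodal π) (hB : B ∈ π.parts)
    (ha : a ∈ B) : -a ∉ B := fun h =>
  Finset.disjoint_left.1 (hπ.disjoint_neg hB) ha (Finset.mem_neg'.2 h)

theorem IsAntipodal.restrict {t : Finset α} {π : Finpartition s} (hπ : IsAntipodal π) (h : t ⊆ s)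
    (ht : -t = t) : IsAntipodal (π.restrict (b := t) h) := by
  constructor <;> intro B hB <;> obtain ⟨hB₀, C, hC, rfl⟩ := (finpartition_mem_restrict h).1 hB
  · refine (finpartition_mem_restrict h).2 ⟨mt Finset.neg_eq_empty.1 hB₀, -C, hπ.neg_mem C hC, ?_⟩
    rw [Finset.neg_inter, ht]
  · obtain ⟨x, hx⟩ := Finset.nonempty_iff_ne_empty.2 hB₀
    intro heq
    exact hπ.neg_notMem hC (Finset.mem_inter.1 hx).1
      (Finset.mem_inter.1 (Finset.mem_neg'.1 (heq ▸ hx))).1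

variable {π : Finpartition s}

theorem IsAntipodal.subset_and_disjoint_neg (hπ : IsAntipodal π) (hB : B ∈ insert ∅ π.parts) :
    B ⊆ s ∧ Disjoint B (-B) := by
  obtain rfl | hB := Finset.mem_insert.1 hB
  · simp
  · exact ⟨π.subset hB, hπ.disjoint_neg hB⟩

theorem IsAntipodal.parts_avoid (hπ : IsAntipodal π) (hB : B ∈ insert ∅ π.parts) :
    (π.avoid (B ∪ -B)).parts = (π.parts.erase B).erase (-B) := by
  have hdisj : ∀ D ∈ π.parts, ∀ E ∈ insert ∅ π.parts, D ≠ E → Disjoint D E := by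
    intro D hD E hE hne
    obtain rfl | hE := Finset.mem_insert.1 hE
    exacts [Finset.disjoint_empty_right D, π.disjoint hD hE hne]
  have hB' : -B ∈ insert ∅ π.parts := by
    obtain rfl | hB := Finset.mem_insert.1 hB
    exacts [by simp, Finset.mem_insert_of_mem (hπ.neg_mem B hB)]
  have key : ∀ D ∈ π.parts, D ≠ B → D ≠ -B → D \ (B ∪ -B) = D := fun D hD h₁ h₂ =>
    Finset.sdiff_eq_self_of_disjoint
      (Finset.disjoint_union_right.2 ⟨hdisj D hD B hB h₁, hdisj D hD _ hB' h₂⟩)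
  ext C
  simp only [Finpartition.mem_avoid, Finset.mem_erase]
  constructor
  · rintro ⟨D, hD, hDB, rfl⟩
    have h₁ : D ≠ B := fun h => hDB (h ▸ Finset.subset_union_left)
    have h₂ : D ≠ -B := fun h => hDB (h ▸ Finset.subset_union_right)
    rw [key D hD h₁ h₂]
    exact ⟨h₂, h₁, hD⟩
  · rintro ⟨h₂, h₁, hC⟩
    refine ⟨C, hC, fun hle => π.ne_empty hC ?_, key C hC h₁ h₂⟩
    rw [← key C hC h₁ h₂, Finset.sdiff_eq_empty_iff_subset]
    exact hle

/-- The partition of `s ∪ {a, -a}` obtained from a partition of `s` by replacing the blocks `B` and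
`-B` with `B ∪ {a}` and `-B ∪ {-a}`. Choosing `B = ∅` adds the new blocks `{a}` and `{-a}`. -/
def IsAntipodal.adjoinPair (hπ : IsAntipodal π) (hs : -s = s) (ha : a ∉ s) (ha' : -a ≠ a)
    (hB : B ∈ insert ∅ π.parts) : Finpartition (insert a (insert (-a) s)) :=
  have hna : -a ∉ s := neg_notMem_of_neg_eq hs ha
  have hBs : B ⊆ s := (hπ.subset_and_disjoint_neg hB).1
  have hd : Disjoint B (-B) := (hπ.subset_and_disjoint_neg hB).2
  have hnBs : -B ⊆ s := neg_subset_of_subset hs hBs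
  ((π.avoid (B ∪ -B)).extend (b := insert a B) (c := s \ (B ∪ -B) ∪ insert a B)
    (Finset.insert_ne_empty a B) (by simp only [Finset.disjoint_left]; grind) rfl).extend
    (b := insert (-a) (-B)) (Finset.insert_ne_empty _ _)
    (by simp only [Finset.disjoint_left] at hd ⊢; grind)
    (by ext; simp only [Finset.sup_eq_union]; grind)

variable (hπ : IsAntipodal π) (hs : -s = s) (ha : a ∉ s) (ha' : -a ≠ a)
  (hB : B ∈ insert ∅ π.parts)
include hπ hs ha ha' hB

theorem IsAntipodal.parts_adjoinPair : (hπ.adjoinPair hs ha ha' hB).parts =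
    insert (insert (-a) (-B)) (insert (insert a B) ((π.parts.erase B).erase (-B))) := by
  rw [← hπ.parts_avoid hB]
  rfl

theorem IsAntipodal.card_parts_adjoinPair : (hπ.adjoinPair hs ha ha' hB).parts.card =
    if B = ∅ then π.parts.card + 2 else π.parts.card := by
  have hcard : (hπ.adjoinPair hs ha ha' hB).parts.card =
      ((π.parts.erase B).erase (-B)).card + 2 := by
    rw [← hπ.parts_avoid hB, adjoinPair, Finpartition.card_extend, Finpartition.card_extend]
  rw [hcard]
  obtain rfl | hB := Finset.mem_insert.1 hB
  · simp [π.empty_notMem_parts]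
  · have hnB : -B ∈ π.parts.erase B := Finset.mem_erase.2 ⟨hπ.neg_ne B hB, hπ.neg_mem B hB⟩
    rw [if_neg (π.ne_empty hB), ← Finset.card_erase_add_one hB, ← Finset.card_erase_add_one hnB]

theorem IsAntipodal.mem_adjoinPair : C ∈ (hπ.adjoinPair hs ha ha' hB).parts ↔
    C = insert (-a) (-B) ∨ C = insert a B ∨ C ≠ -B ∧ C ≠ B ∧ C ∈ π.parts := by
  simp only [hπ.parts_adjoinPair, Finset.mem_insert, Finset.mem_erase]

theorem IsAntipodal.isAntipodal_adjoinPair : IsAntipodal (hπ.adjoinPair hs ha ha' hB) := by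
  have : -a ∉ s := neg_notMem_of_neg_eq hs ha
  have hnB : -B ⊆ s := neg_subset_of_subset hs (hπ.subset_and_disjoint_neg hB).1
  constructor
  · intro C hC
    rw [hπ.mem_adjoinPair hs ha ha' hB] at hC ⊢
    obtain rfl | rfl | ⟨h₁, h₂, hC⟩ := hC
    · simp [finset_neg_neg]
    · simp
    · refine .inr (.inr ⟨fun h => h₂ ?_, fun h => h₁ ?_, hπ.neg_mem C hC⟩)
      · rw [← finset_neg_neg C, h, finset_neg_neg]
      · rw [← finset_neg_neg C, h]
  · intro C hC
    rw [hπ.mem_adjoinPair hs ha ha' hB] at hC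
    have key : insert a B ≠ insert (-a) (-B) := fun h => by
      have := h ▸ Finset.mem_insert_self a B
      grind
    obtain rfl | rfl | ⟨-, -, hC⟩ := hC
    · simpa [finset_neg_neg] using key
    · simpa using key.symm
    · exact hπ.neg_ne C hC

theorem IsAntipodal.erase_part_adjoinPair :
    ((hπ.adjoinPair hs ha ha' hB).part a).erase a = B := by
  have hmem := (hπ.mem_adjoinPair hs ha ha' hB (C := insert a B)).2 (by simp)
  rw [Finpartition.part_eq_of_mem _ hmem (Finset.mem_insert_self a B),
    Finset.erase_insert fun h => ha ((hπ.subset_and_disjoint_neg hB).1 h)]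

theorem IsAntipodal.restrict_adjoinPair (hsub : s ⊆ insert a (insert (-a) s)) :
    (hπ.adjoinPair hs ha ha' hB).restrict (b := s) hsub = π := by
  have hna : -a ∉ s := neg_notMem_of_neg_eq hs ha
  have hBs := (hπ.subset_and_disjoint_neg hB).1
  have hnBs : -B ⊆ s := neg_subset_of_subset hs hBs
  refine finpartition_eq_of_parts_subset fun C hC => ?_
  obtain ⟨hC₀, D, hD, rfl⟩ := (finpartition_mem_restrict hsub).1 hC
  have hB' : B ≠ ∅ → B ∈ π.parts := (Finset.mem_insert.1 hB).resolve_left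
  rw [hπ.mem_adjoinPair hs ha ha' hB] at hD
  obtain rfl | rfl | ⟨-, -, hD⟩ := hD
  · rw [Finset.insert_inter_of_notMem hna, Finset.inter_eq_left.2 hnBs] at hC₀ ⊢
    exact hπ.neg_mem B (hB' (mt Finset.neg_eq_empty.2 hC₀))
  · rw [Finset.insert_inter_of_notMem ha, Finset.inter_eq_left.2 hBs] at hC₀ ⊢
    exact hB' hC₀
  · rwa [Finset.inter_eq_left.2 (π.subset hD)]

end Adjoin

section Recursion

variable {α : Type*} [DecidableEq α] [InvolutiveNeg α] {s : Finset α} {a : α}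

open Classical in
/-- The set of antipodal partitions of `s`. -/
noncomputable def antipodalPartitions (s : Finset α) : Finset (Finpartition s) :=
  Finset.univ.filter IsAntipodal

theorem mem_antipodalPartitions {π : Finpartition s} :
    π ∈ antipodalPartitions s ↔ IsAntipodal π := by
  simp [antipodalPartitions]

variable {ρ : Finpartition (insert a (insert (-a) s))} {π : Finpartition s}

theorem subset_insert_insert_neg (s : Finset α) (a : α) : s ⊆ insert a (insert (-a) s) :=
  (Finset.subset_insert (-a) s).trans (Finset.subset_insert a _)

theorem IsAntipodal.part_inter (hρ : IsAntipodal ρ) (ha : a ∉ s) :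
    ρ.part a ∩ s = (ρ.part a).erase a := by
  have hmem : a ∈ ρ.part a := ρ.mem_part (Finset.mem_insert_self a _)
  have hsub : ρ.part a ⊆ insert a (insert (-a) s) := ρ.part_subset a
  have hna : -a ∉ ρ.part a := hρ.neg_notMem (ρ.part_mem.2 (Finset.mem_insert_self a _)) hmem
  grind

theorem IsAntipodal.erase_part_mem (hρ : IsAntipodal ρ) (ha : a ∉ s) :
    (ρ.part a).erase a ∈
      insert ∅ (ρ.restrict (b := s) (subset_insert_insert_neg s a)).parts := by
  rw [Finset.mem_insert, finpartition_mem_restrict, ← hρ.part_inter ha, or_iff_not_imp_left]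
  exact fun h => ⟨h, _, ρ.part_mem.2 (Finset.mem_insert_self a _), rfl⟩

theorem IsAntipodal.adjoinPair_erase_part (hρ : IsAntipodal ρ) (hπ : IsAntipodal π) (hs : -s = s)
    (ha : a ∉ s) (ha' : -a ≠ a) (hB : (ρ.part a).erase a ∈ insert ∅ π.parts)
    (hρπ : ρ.restrict (b := s) (subset_insert_insert_neg s a) = π) :
    hπ.adjoinPair hs ha ha' hB = ρ := by
  subst hρπ
  have hpart : ρ.part a ∈ ρ.parts := ρ.part_mem.2 (Finset.mem_insert_self a _)
  have hmem : a ∈ ρ.part a := ρ.mem_part (Finset.mem_insert_self a _)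
  have hinsert : insert a ((ρ.part a).erase a) = ρ.part a := Finset.insert_erase hmem
  refine finpartition_eq_of_parts_subset fun C hC => ?_
  rw [hπ.mem_adjoinPair hs ha ha' hB, ← Finset.neg_insert, hinsert, ← hρ.part_inter ha] at hC
  obtain rfl | rfl | ⟨hnC, hC, hCmem⟩ := hC
  · exact hρ.neg_mem _ hpart
  · exact hpart
  · obtain ⟨-, D, hD, rfl⟩ := (finpartition_mem_restrict _).1 hCmem
    have haD : a ∉ D := fun h => hC (ρ.part_eq_of_mem hD h ▸ rfl)
    have hnaD : -a ∉ D := fun h => hnC <| by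
      rw [Finset.neg_inter, hs, ρ.part_eq_of_mem (hρ.neg_mem D hD) (Finset.mem_neg'.2 h),
        finset_neg_neg]
    rwa [Finset.inter_eq_left.2]
    have := ρ.subset hD
    grind

theorem IsAntipodal.sum_restrict_eq {M : Type*} [AddCommMonoid M] (hπ : IsAntipodal π)
    (hs : -s = s) (ha : a ∉ s) (ha' : -a ≠ a) (f : ℕ → M) :
    ∑ ρ ∈ antipodalPartitions (insert a (insert (-a) s)) with
        ρ.restrict (b := s) (subset_insert_insert_neg s a) = π, f ρ.parts.card =
      f (π.parts.card + 2) + π.parts.card • f π.parts.card := by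
  have hsum : ∑ B ∈ insert ∅ π.parts, f (if B = ∅ then π.parts.card + 2 else π.parts.card) =
      f (π.parts.card + 2) + π.parts.card • f π.parts.card := by
    rw [Finset.sum_insert π.empty_notMem_parts, if_pos rfl, Finset.sum_congr rfl fun B hB => by
      rw [if_neg (π.ne_empty hB)], Finset.sum_const]
  rw [← hsum]
  symm
  refine Finset.sum_bij' (fun B hB => hπ.adjoinPair hs ha ha' hB)
    (fun ρ _ => (ρ.part a).erase a) (fun B hB => ?_) (fun ρ hρ => ?_) (fun B hB => ?_)
    (fun ρ hρ => ?_) (fun B hB => ?_)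
  · rw [Finset.mem_filter, mem_antipodalPartitions]
    exact ⟨hπ.isAntipodal_adjoinPair hs ha ha' hB, hπ.restrict_adjoinPair hs ha ha' hB _⟩
  · obtain ⟨hρ, h⟩ := Finset.mem_filter.1 hρ
    exact h ▸ (mem_antipodalPartitions.1 hρ).erase_part_mem ha
  · exact hπ.erase_part_adjoinPair hs ha ha' hB
  · obtain ⟨hρ, h⟩ := Finset.mem_filter.1 hρ
    exact (mem_antipodalPartitions.1 hρ).adjoinPair_erase_part hπ hs ha ha' _ h
  · rw [hπ.card_parts_adjoinPair hs ha ha' hB]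

theorem sum_antipodalPartitions_insert_insert_neg {M : Type*} [AddCommMonoid M]
    (hs : -s = s) (ha : a ∉ s) (ha' : -a ≠ a) (f : ℕ → M) :
    ∑ ρ ∈ antipodalPartitions (insert a (insert (-a) s)), f ρ.parts.card =
      ∑ π ∈ antipodalPartitions s,
        (f (π.parts.card + 2) + π.parts.card • f π.parts.card) := by
  rw [← Finset.sum_fiberwise_of_maps_to (t := antipodalPartitions s)
    (g := fun ρ => ρ.restrict (b := s) (subset_insert_insert_neg s a)) fun ρ hρ =>
      mem_antipodalPartitions.2 ((mem_antipodalPartitions.1 hρ).restrict _ hs)]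
  exact Finset.sum_congr rfl fun π hπ =>
    (mem_antipodalPartitions.1 hπ).sum_restrict_eq hs ha ha' f

end Recursion

section BlockPairs

variable {n : ℕ} {π : Finpartition (signedSet n)}

theorem isAntipodal_iff_isTypeB_and_forall_not_isZeroBlock :
    IsAntipodal π ↔ IsTypeB π ∧ ∀ B ∈ π.parts, ¬ IsZeroBlock B := by
  refine ⟨fun h => ⟨⟨h.neg_mem, fun B hB _ _ hzero _ => ?_⟩, fun B hB hzero => ?_⟩,
    fun h => ⟨h.1.neg_mem, fun B hB heq => h.2 B hB heq.symm⟩⟩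
  · exact absurd hzero.symm (h.neg_ne B hB)
  · exact h.neg_ne B hB hzero.symm

theorem IsAntipodal.card_parts (hπ : IsAntipodal π) :
    π.parts.card = 2 * (blockPairs π).card := by
  have hpairs : blockPairs π = π.parts.image fun B => s(B, -B) := by
    rw [blockPairs, Finset.filter_true_of_mem
      (isAntipodal_iff_isTypeB_and_forall_not_isZeroBlock.1 hπ).2]
  have hfiber : ∀ B ∈ π.parts, π.parts.filter (fun C => s(C, -C) = s(B, -B)) = {B, -B} := by
    intro B hB
    ext C
    simp only [Finset.mem_filter, Finset.mem_insert, Finset.mem_singleton, Sym2.eq_iff]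
    constructor
    · rintro ⟨-, ⟨h, -⟩ | ⟨h, -⟩⟩
      exacts [.inl h, .inr h]
    · rintro (rfl | rfl)
      exacts [⟨hB, .inl ⟨rfl, rfl⟩⟩, ⟨hπ.neg_mem B hB, .inr ⟨rfl, neg_neg B⟩⟩]
  rw [hpairs, Finset.card_eq_sum_card_image (fun B => s(B, -B)) π.parts, mul_comm,
    ← smul_eq_mul, ← Finset.sum_const]
  refine Finset.sum_congr rfl fun p hp => ?_
  obtain ⟨B, hB, rfl⟩ := Finset.mem_image.1 hp
  rw [hfiber B hB, Finset.card_pair (hπ.neg_ne B hB).symm]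

theorem neg_signedSet (n : ℕ) : -signedSet n = signedSet n := by
  ext x
  simp only [signedSet, Finset.mem_neg', Finset.mem_erase, Finset.mem_Icc]
  omega

theorem signedSet_succ (n : ℕ) :
    signedSet (n + 1) = insert (n + 1 : ℤ) (insert (-(n + 1 : ℤ)) (signedSet n)) := by
  ext x
  simp only [signedSet, Finset.mem_insert, Finset.mem_erase, Finset.mem_Icc]
  push_cast
  omega

theorem succ_notMem_signedSet (n : ℕ) : (n + 1 : ℤ) ∉ signedSet n := by
  simp only [signedSet, Finset.mem_erase, Finset.mem_Icc]
  omega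

noncomputable instance (n : ℕ) : Fintype (BPartitionNoZero n) := Fintype.ofFinite _

variable {M : Type*} [AddCommMonoid M]

theorem sum_antipodalPartitions_signedSet (f : ℕ → M) :
    ∑ π ∈ antipodalPartitions (signedSet n), f π.parts.card =
      ∑ π : BPartitionNoZero n, f (2 * (blockPairs π.1).card) := by
  symm
  refine Finset.sum_bij (fun π _ => π.1) (fun π _ => ?_) (fun π _ ρ _ h => Subtype.ext h)
    (fun π hπ => ?_) (fun π _ => ?_)
  · exact mem_antipodalPartitions.2 (isAntipodal_iff_isTypeB_and_forall_not_isZeroBlock.2 π.2)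
  · rw [mem_antipodalPartitions, isAntipodal_iff_isTypeB_and_forall_not_isZeroBlock] at hπ
    exact ⟨⟨π, hπ⟩, Finset.mem_univ _, rfl⟩
  · rw [(isAntipodal_iff_isTypeB_and_forall_not_isZeroBlock.2 π.2).card_parts]

theorem sum_blockPairs_zero (f : ℕ → M) :
    ∑ π : BPartitionNoZero 0, f (blockPairs π.1).card = f 0 := by
  have hempty : signedSet 0 = ∅ := by simp [signedSet]
  have hparts : ∀ π : BPartitionNoZero 0, π.1.parts = ∅ := fun π =>
    Finpartition.parts_eq_empty_iff.2 hempty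
  have : Unique (BPartitionNoZero 0) :=
    { default := Classical.arbitrary _
      uniq := fun π => Subtype.ext (Finpartition.ext ((hparts _).trans (hparts _).symm)) }
  rw [Fintype.sum_unique, blockPairs, hparts]
  rfl

theorem sum_blockPairs_succ (f : ℕ → M) :
    ∑ π : BPartitionNoZero (n + 1), f (blockPairs π.1).card =
      ∑ π : BPartitionNoZero n, (f ((blockPairs π.1).card + 1) +
        (2 * (blockPairs π.1).card) • f (blockPairs π.1).card) := by
  have hsucc := sum_antipodalPartitions_insert_insert_neg (neg_signedSet n)
    (succ_notMem_signedSet n) (by omega) fun k => f (k / 2)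
  rw [← signedSet_succ, sum_antipodalPartitions_signedSet fun k => f (k / 2),
    sum_antipodalPartitions_signedSet fun k => f ((k + 2) / 2) + k • f (k / 2)] at hsucc
  simpa [Nat.mul_add_one] using hsucc

end BlockPairs

section RealRooted

open Polynomial

theorem im_sum_one_div_sub_ofReal (s : Multiset ℝ) (z : ℂ) :
    (s.map fun r : ℝ => 1 / (z - r)).sum.im =
      -z.im * (s.map fun r : ℝ => (Complex.normSq (z - r))⁻¹).sum := by
  rw [← Complex.imCLM_apply, map_multiset_sum, Multiset.map_map, ← Multiset.sum_map_mul_left]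
  simp [Complex.inv_im, div_eq_mul_inv]

theorem im_sum_one_div_sub_ofReal_ne_zero {s : Multiset ℝ} (hs : s ≠ 0) {z : ℂ} (hz : z.im ≠ 0) :
    (s.map fun r : ℝ => 1 / (z - r)).sum.im ≠ 0 := by
  rw [im_sum_one_div_sub_ofReal]
  refine mul_ne_zero (neg_ne_zero.2 hz) (ne_of_gt ?_)
  obtain ⟨r, hr⟩ := Multiset.exists_mem_of_ne_zero hs
  have hzr : z - r ≠ 0 := fun h => hz (by simpa using congrArg Complex.im h)
  refine (inv_pos.2 (Complex.normSq_pos.2 hzr)).trans_le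
    (Multiset.single_le_sum (fun x hx => ?_) _ (Multiset.mem_map_of_mem _ hr))
  obtain ⟨t, -, rfl⟩ := Multiset.mem_map.1 hx
  exact inv_nonneg.2 (Complex.normSq_nonneg _)

/-- At a nonreal root of `p + c p'` the logarithmic derivative `p' / p = ∑ 1 / (z - r)` would equal
`-1 / c`, but its imaginary part does not vanish. -/
theorem splits_add_C_mul_derivative {p : ℝ[X]} (hp : p.Splits) (c : ℝ) :
    (p + C c * derivative p).Splits := by
  refine Splits.of_splits_map (algebraMap ℝ ℂ) (IsAlgClosed.splits _) fun z hz => ?_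
  suffices him : z.im = 0 from ⟨z.re, Complex.ext rfl him.symm⟩
  by_contra him
  set q : ℂ[X] := p.map (algebraMap ℝ ℂ) with hq
  have hroots : q.roots = p.roots.map (algebraMap ℝ ℂ) := hp.roots_map _
  have hroot : q.eval z + c * (derivative q).eval z = 0 := by
    simpa [hq, derivative_map] using (mem_roots'.1 hz).2
  have hp₀ : p ≠ 0 := by
    rintro rfl
    simp at hz
  have hqz : q.eval z ≠ 0 := fun h => by
    have hmem : z ∈ q.roots := (mem_roots (map_ne_zero hp₀)).2 h
    obtain ⟨r, -, rfl⟩ := Multiset.mem_map.1 (hroots ▸ hmem)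
    simp at him
  have hlog : (derivative q).eval z / q.eval z =
      (p.roots.map fun r : ℝ => 1 / (z - r)).sum := by
    rw [(hp.map (algebraMap ℝ ℂ)).eval_derivative_div_eval_of_ne_zero hqz, hroots, Multiset.map_map]
    rfl
  have hsum : 1 + c * (p.roots.map fun r : ℝ => 1 / (z - r)).sum = 0 := by
    rw [← hlog]
    field_simp
    rw [hroot, mul_zero]
  have him_sum := congrArg Complex.im hsum
  rw [Complex.add_im, Complex.im_ofReal_mul, Complex.one_im, zero_add, Complex.zero_im] at him_sum
  obtain rfl | hsum_im := mul_eq_zero.1 him_sum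
  · simp at hsum
  · by_cases hs : p.roots = 0
    · simp [hs] at hsum
    · exact im_sum_one_div_sub_ofReal_ne_zero hs him hsum_im

/-- The probability generating function `1 - p + p X` of a Bernoulli variable of parameter `p`. -/
noncomputable def bernoulliGenPoly (p : ℝ) : ℝ[X] := C (1 - p) + C p * X

theorem eval_one_prod_bernoulliGenPoly (s : Multiset ℝ) :
    (s.map bernoulliGenPoly).prod.eval 1 = 1 := by
  simp [eval_multiset_prod, bernoulliGenPoly]

theorem derivative_bernoulliGenPoly (p : ℝ) : derivative (bernoulliGenPoly p) = C p := by
  simp [bernoulliGenPoly]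

theorem eval_one_derivative_prod_bernoulliGenPoly (s : Multiset ℝ) :
    (derivative (s.map bernoulliGenPoly).prod).eval 1 = s.sum := by
  induction s using Multiset.induction_on with
  | empty => simp
  | cons p s ih =>
    simp [ih, eval_one_prod_bernoulliGenPoly, bernoulliGenPoly]

theorem eval_one_derivative_derivative_prod_bernoulliGenPoly (s : Multiset ℝ) :
    (derivative (derivative (s.map bernoulliGenPoly).prod)).eval 1 =
      s.sum ^ 2 - (s.map (· ^ 2)).sum := by
  induction s using Multiset.induction_on with
  | empty => simp
  | cons p s ih =>
    simp only [Multiset.map_cons, Multiset.prod_cons, Multiset.sum_cons, derivative_mul,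
      derivative_bernoulliGenPoly, derivative_add, derivative_C, eval_add, eval_mul, eval_C, ih,
      eval_zero, eval_one_derivative_prod_bernoulliGenPoly]
    simp only [bernoulliGenPoly, eval_add, eval_mul, eval_C, eval_X]
    ring

theorem X_sub_C_eq_C_mul_bernoulliGenPoly {r : ℝ} (hr : r ≠ 1) :
    X - C r = C (1 - r) * bernoulliGenPoly (1 / (1 - r)) := by
  have h : 1 - r ≠ 0 := sub_ne_zero.2 hr.symm
  rw [bernoulliGenPoly, mul_add, ← mul_assoc, ← C_mul, ← C_mul, mul_sub, mul_one_div_cancel h]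
  simp
  ring

theorem exists_eq_prod_bernoulliGenPoly {f : ℝ[X]} (hf : f.Splits)
    (hroot : ∀ r, f.eval r = 0 → r ≤ 0) (hone : f.eval 1 = 1) :
    ∃ s : Multiset ℝ, (∀ p ∈ s, 0 ≤ p ∧ p ≤ 1) ∧ f = (s.map bernoulliGenPoly).prod := by
  have hneg : ∀ r ∈ f.roots, r ≤ 0 := fun r hr => hroot r (mem_roots'.1 hr).2
  refine ⟨f.roots.map fun r => 1 / (1 - r), fun p hp => ?_, ?_⟩
  · obtain ⟨r, hr, rfl⟩ := Multiset.mem_map.1 hp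
    have := hneg r hr
    exact ⟨one_div_nonneg.2 (by linarith), div_le_one_of_le₀ (by linarith) (by linarith)⟩
  · have hfac : f = C (f.leadingCoeff * (f.roots.map fun r => 1 - r).prod) *
        ((f.roots.map fun r => 1 / (1 - r)).map bernoulliGenPoly).prod := by
      conv_lhs => rw [hf.eq_prod_roots]
      rw [Multiset.map_congr rfl fun r hr =>
        X_sub_C_eq_C_mul_bernoulliGenPoly ((hneg r hr).trans_lt one_pos).ne,
        Multiset.prod_map_mul, C_mul, mul_assoc, map_multiset_prod, Multiset.map_map,
        Multiset.map_map]
      rfl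
    have hconst := congrArg (eval 1) hfac
    rw [eval_mul, eval_one_prod_bernoulliGenPoly, eval_C, mul_one, hone] at hconst
    rwa [← hconst, C_1, one_mul] at hfac

end RealRooted

section GenPoly

open Polynomial

variable {Ω : Type*} [Fintype Ω] [MeasurableSpace Ω] [DiscreteMeasurableSpace Ω] {μ : Measure Ω}
  {N : Ω → ℕ}

/-- The probability generating function `∑ k, μ (N = k) X ^ k` of a random variable `N` with values
in `ℕ` on a finite probability space. -/
noncomputable def genPoly (μ : Measure Ω) (N : Ω → ℕ) : ℝ[X] := ∑ ω, μ.real {ω} • X ^ N ω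

variable [IsProbabilityMeasure μ]

theorem linearMap_genPoly {E : Type*} [NormedAddCommGroup E] [NormedSpace ℝ E]
    [CompleteSpace E] (L : ℝ[X] →ₗ[ℝ] E) : L (genPoly μ N) = ∫ ω, L (X ^ N ω) ∂μ := by
  rw [genPoly, map_sum, integral_fintype .of_finite]
  simp_rw [map_smul]

theorem aeval_genPoly (z : ℂ) : aeval z (genPoly μ N) = ∫ ω, z ^ N ω ∂μ := by
  simpa using linearMap_genPoly (μ := μ) (N := N) (aeval (R := ℝ) z).toLinearMap

theorem eval_genPoly (x : ℝ) : (genPoly μ N).eval x = ∫ ω, x ^ N ω ∂μ := by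
  simpa using linearMap_genPoly (μ := μ) (N := N) (leval x)

theorem eval_one_derivative_genPoly : (derivative (genPoly μ N)).eval 1 = ∫ ω, (N ω : ℝ) ∂μ := by
  simpa [derivative_X_pow] using linearMap_genPoly (μ := μ) (N := N) (leval 1 ∘ₗ derivative)

theorem eval_one_derivative_derivative_genPoly :
    (derivative (derivative (genPoly μ N))).eval 1 = ∫ ω, (N ω : ℝ) ^ 2 ∂μ - ∫ ω, (N ω : ℝ) ∂μ := by
  have hpow (k : ℕ) : (derivative (derivative (X ^ k : ℝ[X]))).eval 1 = (k : ℝ) ^ 2 - k := by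
    obtain _ | k := k
    · simp
    · simp [derivative_X_pow]
      ring
  rw [← integral_sub .of_finite .of_finite]
  simpa [hpow] using
    linearMap_genPoly (μ := μ) (N := N) (leval 1 ∘ₗ derivative ∘ₗ derivative)

theorem exists_genPoly_eq_prod_bernoulliGenPoly (h : (genPoly μ N).Splits) :
    ∃ s : Multiset ℝ, (∀ p ∈ s, 0 ≤ p ∧ p ≤ 1) ∧ genPoly μ N = (s.map bernoulliGenPoly).prod := by
  refine exists_eq_prod_bernoulliGenPoly h (fun r hr => ?_) (by simp [eval_genPoly])
  by_contra! hpos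
  have hsupport : (Function.support fun ω => r ^ N ω) = Set.univ :=
    Set.eq_univ_of_forall fun ω => (pow_pos hpos (N ω)).ne'
  have hint : 0 < ∫ ω, r ^ N ω ∂μ := by
    rw [integral_pos_iff_support_of_nonneg (fun ω => (pow_pos hpos (N ω)).le) .of_finite,
      hsupport, measure_univ]
    exact one_pos
  exact hint.ne' ((eval_genPoly r).symm.trans hr)

variable {s : Multiset ℝ}

theorem integral_eq_sum_of_genPoly_eq_prod (h : genPoly μ N = (s.map bernoulliGenPoly).prod) :
    ∫ ω, (N ω : ℝ) ∂μ = s.sum := by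
  rw [← eval_one_derivative_genPoly, h, eval_one_derivative_prod_bernoulliGenPoly]

theorem variance_eq_sum_of_genPoly_eq_prod (h : genPoly μ N = (s.map bernoulliGenPoly).prod) :
    Var[fun ω => (N ω : ℝ); μ] = (s.map fun p => p * (1 - p)).sum := by
  have hsecond := eval_one_derivative_derivative_genPoly (μ := μ) (N := N)
  rw [h, eval_one_derivative_derivative_prod_bernoulliGenPoly,
    integral_eq_sum_of_genPoly_eq_prod h] at hsecond
  have hsum : (s.map fun p => p * (1 - p)).sum = s.sum - (s.map (· ^ 2)).sum := by
    simp only [mul_one_sub, ← pow_two, Multiset.sum_map_sub, Multiset.map_id']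
  rw [variance_eq_sub .of_discrete, hsum, integral_eq_sum_of_genPoly_eq_prod h]
  simp only [Pi.pow_apply]
  linarith

end GenPoly

section BlockPairPoly

open Polynomial

/-- The generating polynomial of the `B_n`-partitions without zero-block by number of block
pairs. -/
noncomputable def blockPairPoly (n : ℕ) : ℝ[X] :=
  ∑ π : BPartitionNoZero n, X ^ (blockPairs π.1).card

theorem blockPairPoly_zero : blockPairPoly 0 = 1 :=
  (sum_blockPairs_zero fun k => (X ^ k : ℝ[X])).trans (pow_zero X)

theorem blockPairPoly_succ (n : ℕ) :
    blockPairPoly (n + 1) = X * (blockPairPoly n + C 2 * derivative (blockPairPoly n)) := by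
  rw [blockPairPoly, sum_blockPairs_succ fun k => (X ^ k : ℝ[X]), blockPairPoly,
    derivative_sum, Finset.mul_sum, ← Finset.sum_add_distrib, Finset.mul_sum]
  refine Finset.sum_congr rfl fun π _ => ?_
  rw [derivative_X_pow]
  obtain _ | k := (blockPairs π.1).card
  · simp
  · simp [pow_succ, ← C_ofNat]
    ring

theorem splits_blockPairPoly (n : ℕ) : (blockPairPoly n).Splits := by
  induction n with
  | zero => rw [blockPairPoly_zero]; exact Splits.one
  | succ n ih =>
    rw [blockPairPoly_succ]
    exact Splits.X.mul (splits_add_C_mul_derivative ih 2)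

theorem measureReal_unifBPartitionNoZero_singleton {n : ℕ} (π : BPartitionNoZero n) :
    (unifBPartitionNoZero n).real {π} = (Fintype.card (BPartitionNoZero n) : ℝ)⁻¹ := by
  simp [unifBPartitionNoZero, uniformOn_univ, Measure.real]

theorem integral_unifBPartitionNoZero {n : ℕ} (f : BPartitionNoZero n → ℝ) :
    ∫ π, f π ∂(unifBPartitionNoZero n) =
      (∑ π, f π) / (Fintype.card (BPartitionNoZero n) : ℝ) := by
  rw [integral_fintype .of_finite]
  simp [measureReal_unifBPartitionNoZero_singleton, ← Finset.mul_sum, div_eq_inv_mul]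

theorem splits_genPoly_blockPairs (n : ℕ) :
    (genPoly (unifBPartitionNoZero n) fun π => (blockPairs π.1).card).Splits := by
  have h : genPoly (unifBPartitionNoZero n) (fun π => (blockPairs π.1).card) =
      C (Fintype.card (BPartitionNoZero n) : ℝ)⁻¹ * blockPairPoly n := by
    simp only [genPoly, blockPairPoly, measureReal_unifBPartitionNoZero_singleton, smul_eq_C_mul,
      Finset.mul_sum]
  rw [h]
  exact (Splits.C _).mul (splits_blockPairPoly n)

end BlockPairPoly

section CenteredBernoulli

theorem norm_multisetProd_sub_multisetProd_le {ι R : Type*} [SeminormedCommRing R]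
    [NormOneClass R] {f g : ι → R} (s : Multiset ι) (hf : ∀ i ∈ s, ‖f i‖ ≤ 1)
    (hg : ∀ i ∈ s, ‖g i‖ ≤ 1) :
    ‖(s.map f).prod - (s.map g).prod‖ ≤ (s.map fun i => ‖f i - g i‖).sum := by
  induction s using Multiset.induction_on with
  | empty => simp
  | cons i s ih =>
    obtain ⟨hfi, hfs⟩ := Multiset.forall_mem_cons.1 hf
    have hgs := (Multiset.forall_mem_cons.1 hg).2
    have hprod : ‖(s.map g).prod‖ ≤ 1 :=
      Multiset.prod_induction (‖·‖ ≤ 1) _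
        (fun a b ha hb => (norm_mul_le a b).trans (mul_le_one₀ ha (norm_nonneg b) hb))
        norm_one.le (by simpa using hgs)
    simp only [Multiset.map_cons, Multiset.prod_cons, Multiset.sum_cons]
    calc ‖f i * (s.map f).prod - g i * (s.map g).prod‖
        = ‖(f i - g i) * (s.map g).prod + f i * ((s.map f).prod - (s.map g).prod)‖ := by ring_nf
      _ ≤ ‖f i - g i‖ * ‖(s.map g).prod‖ + ‖f i‖ * ‖(s.map f).prod - (s.map g).prod‖ :=
        (norm_add_le _ _).trans (add_le_add (norm_mul_le _ _) (norm_mul_le _ _))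
      _ ≤ ‖f i - g i‖ * 1 + 1 * (s.map fun i => ‖f i - g i‖).sum := by
        gcongr
        exact ih hfs hgs
      _ = ‖f i - g i‖ + (s.map fun i => ‖f i - g i‖).sum := by rw [mul_one, one_mul]

open Complex

theorem norm_exp_mul_I_sub_le {x : ℝ} (hx : |x| ≤ 1) :
    ‖exp (x * I) - (1 + x * I - x ^ 2 / 2)‖ ≤ |x| ^ 3 / 2 := by
  have hnorm : ‖(x * I : ℂ)‖ = |x| := by simp
  have hsum : ∑ m ∈ Finset.range 3, (x * I : ℂ) ^ m / m.factorial = 1 + x * I - x ^ 2 / 2 := by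
    simp [Finset.sum_range_succ, mul_pow, Nat.factorial]
    ring
  have hexp := exp_bound (x := x * I) (by rwa [hnorm]) (n := 3) (by norm_num)
  rw [hnorm, hsum] at hexp
  refine hexp.trans ?_
  rw [div_eq_mul_inv]
  gcongr
  norm_num [Nat.factorial]

theorem exp_sum_map_mul {ι : Type*} (s : Multiset ι) (f : ι → ℝ) (a : ℂ) :
    exp ((s.map f).sum * a) = (s.map fun i => exp (f i * a)).prod := by
  induction s using Multiset.induction_on with
  | empty => simp
  | cons i s ih => simp [add_mul, exp_add, ih]

/-- The characteristic function at `u` of `X - p`, where `X` is a Bernoulli variable of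
parameter `p`. -/
noncomputable def centeredBernoulliCharFun (u p : ℝ) : ℂ :=
  (1 - p : ℝ) * exp ((-(u * p) : ℝ) * I) + p * exp ((u * (1 - p) : ℝ) * I)

theorem centeredBernoulliCharFun_eq_mul (u p : ℝ) :
    centeredBernoulliCharFun u p = (1 - p + p * exp (u * I)) * exp (-(u * p) * I) := by
  rw [centeredBernoulliCharFun, add_mul, mul_assoc, ← exp_add]
  push_cast
  ring_nf

variable {u p : ℝ}

theorem norm_centeredBernoulliCharFun_le_one (h0 : 0 ≤ p) (h1 : p ≤ 1) :
    ‖centeredBernoulliCharFun u p‖ ≤ 1 := by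
  refine (norm_add_le _ _).trans_eq ?_
  rw [norm_mul, norm_mul, norm_exp_ofReal_mul_I, norm_exp_ofReal_mul_I, norm_real, norm_real,
    Real.norm_of_nonneg (sub_nonneg.2 h1), Real.norm_of_nonneg h0]
  ring

theorem norm_centeredBernoulliCharFun_sub_taylor_le (h0 : 0 ≤ p) (h1 : p ≤ 1) (hu : |u| ≤ 1) :
    ‖centeredBernoulliCharFun u p - (1 - p * (1 - p) * u ^ 2 / 2)‖ ≤ |u| ^ 3 * (p * (1 - p)) := by
  have hq : 0 ≤ 1 - p := sub_nonneg.2 h1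
  have hterm {a x : ℝ} (ha0 : 0 ≤ a) (ha1 : a ≤ 1) (hx : |x| = |u| * a) :
      ‖((1 - a : ℝ) : ℂ) * (exp (x * I) - (1 + x * I - x ^ 2 / 2))‖ ≤
        |u| ^ 3 * (a * (1 - a)) / 2 := by
    have ha : 0 ≤ 1 - a := sub_nonneg.2 ha1
    rw [norm_mul, norm_real, Real.norm_of_nonneg ha]
    calc (1 - a) * ‖exp (x * I) - (1 + x * I - x ^ 2 / 2)‖
        ≤ (1 - a) * ((|u| * a) ^ 3 / 2) := by
          rw [← hx]
          gcongr
          exact norm_exp_mul_I_sub_le (hx ▸ mul_le_one₀ hu ha0 ha1)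
      _ = |u| ^ 3 * (a * (1 - a)) / 2 * a ^ 2 := by ring
      _ ≤ |u| ^ 3 * (a * (1 - a)) / 2 :=
        mul_le_of_le_one_right (by positivity) (pow_le_one₀ ha0 ha1)
  have hfst := hterm (x := -(u * p)) h0 h1 (by rw [abs_neg, abs_mul, abs_of_nonneg h0])
  have hsnd := hterm (x := u * (1 - p)) hq (sub_le_self 1 h0)
    (by rw [abs_mul, abs_of_nonneg hq])
  refine le_trans (le_of_eq_of_le ?_ (norm_add_le _ _)) (add_le_add hfst hsnd |>.trans_eq (by ring))
  congr 1
  rw [centeredBernoulliCharFun]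
  push_cast
  ring

theorem norm_one_sub_sub_exp_neg_le {v : ℝ} (hv0 : 0 ≤ v) (hv1 : v ≤ 1) (hu : |u| ≤ 1) :
    ‖(1 - v * u ^ 2 / 2 : ℂ) - exp ((-(v * u ^ 2 / 2) : ℝ))‖ ≤ |u| ^ 3 * v := by
  set y := v * |u| ^ 2 / 2 with hy
  have hy0 : 0 ≤ y := by positivity
  have hy1 : y ≤ 1 := by
    have := mul_le_one₀ hv1 (by positivity) (pow_le_one₀ (n := 2) (abs_nonneg u) hu)
    linarith
  have hnorm : ‖((-y : ℝ) : ℂ)‖ = y := by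
    rw [norm_real, norm_neg, Real.norm_of_nonneg hy0]
  have hexp := norm_exp_sub_one_sub_id_le (x := ((-y : ℝ) : ℂ)) (hnorm.trans_le hy1)
  rw [hnorm, ← norm_neg] at hexp
  calc ‖(1 - v * u ^ 2 / 2 : ℂ) - exp ((-(v * u ^ 2 / 2) : ℝ))‖
      = ‖-(exp ((-y : ℝ) : ℂ) - 1 - ((-y : ℝ) : ℂ))‖ := by
        rw [hy, sq_abs]
        congr 1
        push_cast
        ring
    _ ≤ y ^ 2 := hexp
    _ = |u| ^ 3 * v * (v * |u| / 4) := by rw [hy]; ring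
    _ ≤ |u| ^ 3 * v :=
      mul_le_of_le_one_right (by positivity)
        (by linarith [mul_le_one₀ hv1 (abs_nonneg u) hu])

theorem norm_centeredBernoulliCharFun_sub_exp_le (h0 : 0 ≤ p) (h1 : p ≤ 1) (hu : |u| ≤ 1) :
    ‖centeredBernoulliCharFun u p - exp ((-(p * (1 - p) * u ^ 2 / 2) : ℝ))‖ ≤
      2 * |u| ^ 3 * (p * (1 - p)) := by
  have hq : 0 ≤ 1 - p := sub_nonneg.2 h1
  have hexp := norm_one_sub_sub_exp_neg_le (mul_nonneg h0 hq)
    (mul_le_one₀ h1 hq (sub_le_self 1 h0)) hu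
  push_cast at hexp ⊢
  refine (norm_sub_le_norm_sub_add_norm_sub _ _ _).trans
    ((add_le_add (norm_centeredBernoulliCharFun_sub_taylor_le h0 h1 hu) hexp).trans_eq (by ring))

theorem norm_prod_centeredBernoulliCharFun_sub_exp_le {s : Multiset ℝ}
    (hs : ∀ p ∈ s, 0 ≤ p ∧ p ≤ 1) (hu : |u| ≤ 1) :
    ‖(s.map (centeredBernoulliCharFun u)).prod -
        exp ((-((s.map fun p => p * (1 - p)).sum * u ^ 2 / 2) : ℝ))‖ ≤
      2 * |u| ^ 3 * (s.map fun p => p * (1 - p)).sum := by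
  have hexp (v : ℝ) : exp ((-(v * u ^ 2 / 2) : ℝ)) = exp (v * -(u ^ 2 / 2 : ℂ)) := by
    push_cast
    ring_nf
  simp only [hexp, exp_sum_map_mul]
  rw [← Multiset.sum_map_mul_left]
  refine (norm_multisetProd_sub_multisetProd_le s
    (fun p hp => norm_centeredBernoulliCharFun_le_one (hs p hp).1 (hs p hp).2) fun p hp => ?_).trans
    (Multiset.sum_map_le_sum_map _ _ fun p hp =>
      hexp _ ▸ norm_centeredBernoulliCharFun_sub_exp_le (hs p hp).1 (hs p hp).2 hu)
  rw [← hexp, norm_exp_ofReal, Real.exp_le_one_iff, neg_nonpos]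
  have := mul_nonneg (hs p hp).1 (sub_nonneg.2 (hs p hp).2)
  positivity

end CenteredBernoulli

section CentralLimit

theorem charFun_map_sub_div_of_genPoly_eq_prod {Ω : Type*} [Fintype Ω] [MeasurableSpace Ω]
    [DiscreteMeasurableSpace Ω] {μ : Measure Ω} [IsProbabilityMeasure μ] {N : Ω → ℕ}
    {s : Multiset ℝ} (h : genPoly μ N = (s.map bernoulliGenPoly).prod) (σ t : ℝ) :
    charFun (μ.map fun ω => (N ω - s.sum) / σ) t =
      (s.map (centeredBernoulliCharFun (t / σ))).prod := by
  have hsum : Complex.exp (s.sum * (-(t / σ) * Complex.I)) =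
      (s.map fun p : ℝ => Complex.exp (p * (-(t / σ) * Complex.I))).prod := by
    simpa using exp_sum_map_mul s id (-(t / σ) * Complex.I)
  have hexp (ω : Ω) : Complex.exp (t * ((N ω - s.sum) / σ : ℝ) * Complex.I) =
      Complex.exp ((t / σ : ℝ) * Complex.I) ^ N ω *
        Complex.exp (s.sum * (-(t / σ) * Complex.I)) := by
    rw [← Complex.exp_nat_mul, ← Complex.exp_add]
    congr 1
    push_cast
    ring
  rw [charFun_apply_real, integral_map Measurable.of_discrete.aemeasurable (by fun_prop)]
  simp only [hexp, integral_mul_const, ← aeval_genPoly, h, hsum, map_multiset_prod,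
    Multiset.map_map, Function.comp_def, ← Multiset.prod_map_mul]
  refine congrArg Multiset.prod (Multiset.map_congr rfl fun p _ => ?_)
  have hpow : Complex.exp (p * (-(t / σ) * Complex.I)) =
      Complex.exp (-((t / σ : ℝ) * p) * Complex.I) := by
    push_cast
    ring_nf
  rw [centeredBernoulliCharFun_eq_mul, ← hpow]
  simp [bernoulliGenPoly]

theorem norm_charFun_standardized_sub_exp_le {Ω : Type*} [Fintype Ω] [MeasurableSpace Ω]
    [DiscreteMeasurableSpace Ω] {μ : Measure Ω} [IsProbabilityMeasure μ] {N : Ω → ℕ}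
    (h : (genPoly μ N).Splits) {t : ℝ} (hpos : 0 < Var[fun ω => (N ω : ℝ); μ])
    (ht : |t| ≤ √Var[fun ω => (N ω : ℝ); μ]) :
    ‖charFun (μ.map fun ω => (N ω - ∫ ω', (N ω' : ℝ) ∂μ) / √Var[fun ω => (N ω : ℝ); μ]) t -
        Complex.exp ((-(t ^ 2 / 2) : ℝ))‖ ≤ 2 * |t| ^ 3 / √Var[fun ω => (N ω : ℝ); μ] := by
  obtain ⟨s, hs, hprod⟩ := exists_genPoly_eq_prod_bernoulliGenPoly h
  rw [integral_eq_sum_of_genPoly_eq_prod hprod, charFun_map_sub_div_of_genPoly_eq_prod hprod]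
  rw [variance_eq_sum_of_genPoly_eq_prod hprod] at hpos ht ⊢
  set v := (s.map fun p => p * (1 - p)).sum
  have hσ : 0 < √v := Real.sqrt_pos.2 hpos
  have hv : v = √v ^ 2 := (Real.sq_sqrt hpos.le).symm
  have habs : |t / √v| = |t| / √v := by rw [abs_div, abs_of_pos hσ]
  have hbound := norm_prod_centeredBernoulliCharFun_sub_exp_le hs
    (habs ▸ (div_le_one hσ).2 ht : |t / √v| ≤ 1)
  have hexponent : v * (t / √v) ^ 2 / 2 = t ^ 2 / 2 := by
    rw [div_pow, ← hv, mul_div_cancel₀ _ hpos.ne']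
  have herror : 2 * |t / √v| ^ 3 * v = 2 * |t| ^ 3 / √v := by
    rw [habs]
    nth_rw 2 [hv]
    field_simp
  rwa [hexponent, herror] at hbound

theorem tendstoInDistribution_standardized_of_splits_genPoly {Ω : ℕ → Type*} [∀ n, Fintype (Ω n)]
    [∀ n, MeasurableSpace (Ω n)] [∀ n, DiscreteMeasurableSpace (Ω n)] {μ : ∀ n, Measure (Ω n)}
    [∀ n, IsProbabilityMeasure (μ n)] {N : ∀ n, Ω n → ℕ} (h : ∀ n, (genPoly (μ n) (N n)).Splits)
    (hvar : Tendsto (fun n => Var[fun ω => (N n ω : ℝ); μ n]) atTop atTop) :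
    TendstoInDistribution
      (fun n ω => (N n ω - ∫ ω', (N n ω' : ℝ) ∂μ n) / √Var[fun ω' => (N n ω' : ℝ); μ n])
      atTop (id : ℝ → ℝ) μ (gaussianReal 0 1) := by
  refine ⟨fun n => Measurable.of_discrete.aemeasurable, aemeasurable_id, ?_⟩
  refine ProbabilityMeasure.tendsto_iff_tendsto_charFun.2 fun t => ?_
  have hgauss : charFun (gaussianReal 0 1) t = Complex.exp ((-(t ^ 2 / 2) : ℝ)) := by
    simp [charFun_gaussianReal]
  simp only [ProbabilityMeasure.coe_mk, Measure.map_id, hgauss]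
  have hsqrt := Real.tendsto_sqrt_atTop.comp hvar
  refine tendsto_iff_norm_sub_tendsto_zero.2 <| squeeze_zero' (.of_forall fun _ => norm_nonneg _) ?_
    (tendsto_const_nhds (x := 2 * |t| ^ 3) |>.div_atTop hsqrt)
  filter_upwards [hvar.eventually_gt_atTop 0, hsqrt.eventually_ge_atTop |t|] with n hpos ht
  exact norm_charFun_standardized_sub_exp_le (h n) hpos ht

end CentralLimit

section CramerRao

theorem hasSum_succ_of_zero {f : ℕ → ℝ} {S : ℝ} (hf : HasSum f S) (hf0 : f 0 = 0) :
    HasSum (fun j => f (j + 1)) S := by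
  simpa [hf0] using (hasSum_nat_add_iff' 1).2 hf

theorem hasSum_sub_succ_mul_sub {w : ℕ → ℝ} {M₀ M₁ : ℝ} (hw0 : w 0 = 0) (h₀ : HasSum w M₀)
    (h₁ : HasSum (fun j : ℕ => (j : ℝ) * w j) M₁) (c : ℝ) :
    HasSum (fun j => (w j - w (j + 1)) * (↑(j + 1) - c)) M₀ := by
  have hshift := hasSum_succ_of_zero (h₁.sub (h₀.mul_left c)) (by simp [hw0])
  convert! (h₁.add (h₀.mul_left (1 - c))).sub hshift using 2 with j
  · push_cast
    ring
  · ring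

/-- Cauchy–Schwarz between `w j - w (j + 1)` and `j + 1 - c` is applied termwise, with multiplier
`l = 1 / (2 δ)`, so that `∑ j, (w j - w (j + 1)) ^ 2 / w (j + 1)` need not be shown summable.
At `j = 0` the truncated `w (j - 1)` is `w 0 = 0`. -/
theorem one_div_two_mul_le_variance_of_sq_le {w : ℕ → ℝ} {δ M₀ M₁ M₂ : ℝ} (hδ : 0 < δ)
    (hw0 : w 0 = 0) (hw : ∀ j, 0 < w (j + 1))
    (hsq : ∀ j, w j ^ 2 ≤ w (j + 1) * ((1 + δ) * w (j - 1) + δ * w j))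
    (h₀ : HasSum w M₀) (h₁ : HasSum (fun j : ℕ => (j : ℝ) * w j) M₁)
    (h₂ : HasSum (fun j : ℕ => (j : ℝ) ^ 2 * w j) M₂) :
    1 / (2 * δ) ≤ M₂ / M₀ - (M₁ / M₀) ^ 2 := by
  have hM₀ : 0 < M₀ :=
    (hw 0).trans_le (le_hasSum h₀ 1 fun j _ => by cases j; exacts [hw0.ge, (hw _).le])
  set c := M₁ / M₀ with hc
  have hM₁ : M₁ = c * M₀ := by rw [hc, div_mul_cancel₀ _ hM₀.ne']
  have hpred : HasSum (fun j => w (j - 1)) M₀ := by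
    refine (hasSum_nat_add_iff' 1).1 ?_
    simpa [hw0] using h₀
  have hvar : HasSum (fun j => (↑(j + 1) - c) ^ 2 * w (j + 1)) (M₂ - c ^ 2 * M₀) := by
    have hcentered := (h₂.sub (h₁.mul_left (2 * c))).add (h₀.mul_left (c ^ 2))
    convert! hasSum_succ_of_zero hcentered (by simp [hw0]) using 1
    · funext j
      ring
    · rw [hM₁]
      ring
  have hinfo : HasSum
      (fun j => (1 + δ) * w (j - 1) + δ * w j - 2 * w j + w (j + 1)) (2 * δ * M₀) := by
    convert! (((hpred.mul_left (1 + δ)).add (h₀.mul_left δ)).sub (h₀.mul_left 2)).add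
      (hasSum_succ_of_zero h₀ hw0) using 1
    ring
  set l := 1 / (2 * δ) with hl
  have hterm (j : ℕ) : 2 * l * ((w j - w (j + 1)) * (↑(j + 1) - c)) ≤
      l ^ 2 * ((1 + δ) * w (j - 1) + δ * w j - 2 * w j + w (j + 1)) +
        (↑(j + 1) - c) ^ 2 * w (j + 1) := by
    refine le_of_mul_le_mul_right ?_ (hw j)
    nlinarith [mul_le_mul_of_nonneg_left (hsq j) (sq_nonneg l),
      sq_nonneg (l * (w j - w (j + 1)) - (↑(j + 1) - c) * w (j + 1))]
  have hle := hasSum_le hterm ((hasSum_sub_succ_mul_sub hw0 h₀ h₁ c).mul_left (2 * l))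
    ((hinfo.mul_left (l ^ 2)).add hvar)
  have hlδ : l ^ 2 * (2 * δ * M₀) = l * M₀ := by
    rw [hl]
    field_simp
  have hbound : (l + c ^ 2) * M₀ ≤ M₂ := by linarith
  linarith [(le_div_iff₀ hM₀).2 hbound]

end CramerRao

section Dobinski

/-- The `j`-th term of the Dobiński-type series `∑ j, (2 j) ^ n / (2 ^ j j!)`, which sums to `√e`
times the number of `B_n`-partitions without zero-block. -/
noncomputable def dobinskiTerm (n j : ℕ) : ℝ := (2 * j) ^ n * (1 / 2) ^ j / j.factorial

theorem dobinskiTerm_succ_left (n j : ℕ) :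
    dobinskiTerm (n + 1) j = 2 * j * dobinskiTerm n j := by
  unfold dobinskiTerm
  ring

theorem dobinskiTerm_zero_right {n : ℕ} (hn : n ≠ 0) : dobinskiTerm n 0 = 0 := by
  simp [dobinskiTerm, hn]

theorem dobinskiTerm_succ_right_pos (n j : ℕ) : 0 < dobinskiTerm n (j + 1) := by
  unfold dobinskiTerm
  positivity

theorem dobinskiTerm_succ_right_mul (n j : ℕ) :
    dobinskiTerm n (j + 1) * (2 * (j + 1)) * j ^ n = dobinskiTerm n j * (j + 1) ^ n := by
  simp only [dobinskiTerm, mul_pow, Nat.factorial_succ, pow_succ (1 / 2 : ℝ)]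
  push_cast
  field_simp

theorem two_mul_pow_eq_sum_blockPairs (n j : ℕ) :
    (2 * j : ℝ) ^ n = ∑ π : BPartitionNoZero n,
      (2 : ℝ) ^ (blockPairs π.1).card * j.descFactorial (blockPairs π.1).card := by
  induction n with
  | zero =>
    rw [sum_blockPairs_zero fun k => (2 : ℝ) ^ k * j.descFactorial k]
    simp
  | succ n ih =>
    rw [sum_blockPairs_succ fun k => (2 : ℝ) ^ k * j.descFactorial k, pow_succ, ih,
      Finset.sum_mul]
    refine Finset.sum_congr rfl fun π _ => ?_
    generalize (blockPairs π.1).card = k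
    rw [Nat.descFactorial_succ, nsmul_eq_mul]
    obtain hkj | hjk := le_or_gt k j
    · push_cast [Nat.cast_sub hkj]
      ring
    · simp [Nat.descFactorial_of_lt hjk]

theorem hasSum_descFactorial_mul_pow_div_factorial (x : ℝ) (k : ℕ) :
    HasSum (fun j : ℕ => j.descFactorial k * x ^ j / j.factorial) (x ^ k * Real.exp x) := by
  rw [← hasSum_nat_add_iff' k, Finset.sum_eq_zero fun i hi => by
    simp [Nat.descFactorial_of_lt (Finset.mem_range.1 hi)], sub_zero, Real.exp_eq_exp_ℝ]
  convert! (NormedSpace.expSeries_div_hasSum_exp x).mul_left (x ^ k) using 2 with j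
  have hfactorial : ((j + k).factorial : ℝ) = j.factorial * (j + k).descFactorial k := by
    have h := Nat.factorial_mul_descFactorial (Nat.le_add_left k j)
    rw [Nat.add_sub_cancel] at h
    exact_mod_cast h.symm
  have hpos : ((j + k).descFactorial k : ℝ) ≠ 0 := by
    exact_mod_cast (Nat.descFactorial_pos.2 (Nat.le_add_left k j)).ne'
  rw [hfactorial, pow_add]
  field_simp

theorem hasSum_dobinskiTerm (n : ℕ) :
    HasSum (dobinskiTerm n) (Fintype.card (BPartitionNoZero n) * Real.exp (1 / 2)) := by
  have h := hasSum_sum (s := (Finset.univ : Finset (BPartitionNoZero n))) fun π _ =>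
    (hasSum_descFactorial_mul_pow_div_factorial (1 / 2) (blockPairs π.1).card).mul_left
      (2 ^ (blockPairs π.1).card)
  simp only [← mul_assoc, ← mul_pow, mul_one_div_cancel (two_ne_zero' ℝ), one_pow, one_mul,
    Finset.sum_const, nsmul_eq_mul, Finset.card_univ] at h
  convert! h using 2 with j
  rw [dobinskiTerm, two_mul_pow_eq_sum_blockPairs, Finset.sum_mul, Finset.sum_div]
  exact Finset.sum_congr rfl fun π _ => by ring

theorem card_bPartitionNoZero_succ (n : ℕ) :
    (Fintype.card (BPartitionNoZero (n + 1)) : ℝ) =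
      ∑ π : BPartitionNoZero n, (1 + 2 * ((blockPairs π.1).card : ℝ)) := by
  simpa using sum_blockPairs_succ (n := n) fun _ => (1 : ℝ)

theorem card_bPartitionNoZero_add_two (n : ℕ) :
    (Fintype.card (BPartitionNoZero (n + 2)) : ℝ) =
      ∑ π : BPartitionNoZero n, (4 * ((blockPairs π.1).card : ℝ) ^ 2 +
        4 * (blockPairs π.1).card + 3) := by
  rw [card_bPartitionNoZero_succ, sum_blockPairs_succ fun k => (1 + 2 * (k : ℝ))]
  refine Finset.sum_congr rfl fun π _ => ?_
  rw [nsmul_eq_mul]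
  push_cast
  ring

theorem four_mul_variance_numBlockPairs_add_two (n : ℕ) :
    4 * Var[numBlockPairs n; unifBPartitionNoZero n] + 2 =
      Fintype.card (BPartitionNoZero (n + 2)) / Fintype.card (BPartitionNoZero n) -
        (Fintype.card (BPartitionNoZero (n + 1)) / Fintype.card (BPartitionNoZero n) : ℝ) ^ 2 := by
  have hcard : (Fintype.card (BPartitionNoZero n) : ℝ) ≠ 0 := by
    exact_mod_cast Fintype.card_ne_zero
  rw [variance_eq_sub .of_discrete, integral_unifBPartitionNoZero,
    integral_unifBPartitionNoZero, card_bPartitionNoZero_add_two, card_bPartitionNoZero_succ]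
  simp only [numBlockPairs, Pi.pow_apply, Finset.sum_add_distrib, ← Finset.mul_sum,
    Finset.sum_const, Finset.card_univ, nsmul_eq_mul]
  field_simp
  ring

end Dobinski

section VarianceGrowth

theorem pow_mul_exp_div_le {x : ℝ} (hx : 0 ≤ x) (n : ℕ) :
    x ^ n * Real.exp (n / (x + 1)) ≤ (x + 1) ^ n := by
  have hexp : x * Real.exp (1 / (x + 1)) ≤ x + 1 := by
    have hle : x / (x + 1) ≤ Real.exp (-(1 / (x + 1))) := by
      refine le_trans (le_of_eq ?_) (Real.add_one_le_exp _)
      field_simp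
      ring
    rwa [Real.exp_neg, ← one_div, div_le_div_iff₀ (by positivity) (Real.exp_pos _), one_mul] at hle
  rw [div_eq_mul_one_div (n : ℝ), Real.exp_nat_mul, ← mul_pow]
  exact pow_le_pow_left₀ (by positivity) hexp n

theorem dobinskiTerm_le_mul_dobinskiTerm_succ {n j : ℕ} {δ : ℝ}
    (h : 12 * (j + 1 : ℝ) ^ 4 ≤ δ * n ^ 3) :
    dobinskiTerm n j ≤ δ * dobinskiTerm n (j + 1) := by
  have hδ : 0 ≤ δ := by
    by_contra! hneg
    have : 0 < 12 * (j + 1 : ℝ) ^ 4 := by positivity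
    nlinarith [pow_nonneg (Nat.cast_nonneg (α := ℝ) n) 3]
  have hexp : 2 * (j + 1 : ℝ) ≤ δ * Real.exp (n / (j + 1)) := by
    calc 2 * (j + 1 : ℝ) ≤ δ * ((n / (j + 1)) ^ 3 / Nat.factorial 3) := by
          rw [div_pow, div_div, mul_div_assoc', le_div_iff₀ (by positivity)]
          norm_num [Nat.factorial]
          linarith
      _ ≤ δ * Real.exp (n / (j + 1)) := by
          gcongr
          exact Real.pow_div_factorial_le_exp _ (by positivity) 3
  have hpow : (j : ℝ) ^ n * (2 * (j + 1)) ≤ δ * (j + 1) ^ n :=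
    calc (j : ℝ) ^ n * (2 * (j + 1)) ≤ j ^ n * (δ * Real.exp (n / (j + 1))) := by gcongr
      _ = δ * (j ^ n * Real.exp (n / (j + 1))) := by ring
      _ ≤ δ * (j + 1) ^ n := by
        gcongr
        exact pow_mul_exp_div_le j.cast_nonneg n
  refine le_of_mul_le_mul_right ?_ (by positivity : 0 < (j + 1 : ℝ) ^ n)
  calc dobinskiTerm n j * (j + 1) ^ n
      = dobinskiTerm n (j + 1) * (j ^ n * (2 * (j + 1))) := by
        rw [← dobinskiTerm_succ_right_mul]
        ring
    _ ≤ dobinskiTerm n (j + 1) * (δ * (j + 1) ^ n) :=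
      mul_le_mul_of_nonneg_left hpow (dobinskiTerm_succ_right_pos n j).le
    _ = δ * dobinskiTerm n (j + 1) * (j + 1) ^ n := by ring

theorem sq_pow_mul_add_one_le {x δ : ℝ} {n : ℕ} (hx : 1 ≤ x) (hδ : δ ≤ 1) (h : 4 ≤ δ * x)
    (hn : 4 * n ≤ δ * x ^ 2) :
    (x ^ 2) ^ n * (x + 1) ≤ (1 + δ) * x * (x ^ 2 - 1) ^ n := by
  have hx2 : 1 ≤ x ^ 2 := one_le_pow₀ hx
  have hδ0 : 0 ≤ δ := by
    by_contra! hneg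
    nlinarith
  have hbernoulli : 1 - δ / 4 ≤ ((x ^ 2 - 1) / x ^ 2) ^ n := by
    have hle := one_add_mul_le_pow (a := -(1 / x ^ 2))
      (by linarith [div_le_one_of_le₀ hx2 (sq_nonneg x)]) n
    have hn' : n * (1 / x ^ 2) ≤ δ / 4 := by
      rw [mul_one_div, div_le_iff₀ (by positivity)]
      linarith
    rw [sub_div, div_self (by positivity), sub_eq_add_neg 1 (1 / x ^ 2)]
    linarith
  rw [div_pow, le_div_iff₀ (by positivity)] at hbernoulli
  calc (x ^ 2) ^ n * (x + 1) ≤ (x ^ 2) ^ n * ((1 + δ / 4) * x) := by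
        gcongr
        linarith
    _ ≤ (x ^ 2) ^ n * ((1 + δ) * (1 - δ / 4) * x) := by
        gcongr
        nlinarith
    _ = (1 + δ) * x * ((1 - δ / 4) * (x ^ 2) ^ n) := by ring
    _ ≤ (1 + δ) * x * (x ^ 2 - 1) ^ n := by gcongr

theorem sq_dobinskiTerm_succ_le {n j : ℕ} {δ : ℝ} (hδ : δ ≤ 1)
    (h : 4 ≤ δ * (j + 1)) (hn : 4 * n ≤ δ * (j + 1) ^ 2) :
    dobinskiTerm n (j + 1) ^ 2 ≤ (1 + δ) * (dobinskiTerm n (j + 2) * dobinskiTerm n j) := by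
  have hpow := sq_pow_mul_add_one_le (le_add_of_nonneg_left j.cast_nonneg) hδ h hn
  have hj := dobinskiTerm_succ_right_mul n j
  have hj1 := dobinskiTerm_succ_right_mul n (j + 1)
  push_cast at hj1
  refine le_of_mul_le_mul_right ?_
    (by positivity : 0 < ((j + 1 : ℝ) ^ 2) ^ n * (j + 1 + 1))
  calc dobinskiTerm n (j + 1) ^ 2 * (((j + 1 : ℝ) ^ 2) ^ n * (j + 1 + 1))
      ≤ dobinskiTerm n (j + 1) ^ 2 * ((1 + δ) * (j + 1) * (((j : ℝ) + 1) ^ 2 - 1) ^ n) := by gcongr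
    _ = (1 + δ) / 2 * (dobinskiTerm n (j + 1) * (2 * (j + 1)) * j ^ n) *
          (dobinskiTerm n (j + 1) * (j + 1 + 1) ^ n) := by
        rw [show ((j : ℝ) + 1) ^ 2 - 1 = j * (j + 1 + 1) by ring, mul_pow]
        ring
    _ = (1 + δ) * (dobinskiTerm n (j + 2) * dobinskiTerm n j) *
          (((j + 1 : ℝ) ^ 2) ^ n * (j + 1 + 1)) := by
        rw [hj, ← hj1, pow_right_comm]
        ring

theorem dobinskiTerm_succ_le_mul_of_mul_sq_le {n i : ℕ} {δ : ℝ} (hδ : 0 < δ)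
    (hn : 3072 ≤ δ ^ 3 * n) (hi : δ * (i + 1) ^ 2 ≤ 4 * n) :
    dobinskiTerm n (i + 1) ≤ δ * dobinskiTerm n (i + 2) := by
  refine dobinskiTerm_le_mul_dobinskiTerm_succ (le_of_mul_le_mul_right ?_ (pow_pos hδ 2))
  push_cast
  calc 12 * ((i : ℝ) + 1 + 1) ^ 4 * δ ^ 2 ≤ 12 * (2 * (i + 1)) ^ 4 * δ ^ 2 := by
        gcongr
        linarith [i.cast_nonneg (α := ℝ)]
    _ = 192 * (δ * (i + 1) ^ 2) ^ 2 := by ring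
    _ ≤ 192 * (4 * n) ^ 2 := by gcongr
    _ = 3072 * n ^ 2 := by ring
    _ ≤ δ ^ 3 * n * n ^ 2 := by gcongr
    _ = δ * n ^ 3 * δ ^ 2 := by ring

theorem sq_dobinskiTerm_succ_le_of_le_mul_sq {n i : ℕ} {δ : ℝ} (hδ0 : 0 < δ) (hδ1 : δ ≤ 1)
    (hn : 4 ≤ δ * n) (hi : 4 * n ≤ δ * (i + 1) ^ 2) :
    dobinskiTerm n (i + 1) ^ 2 ≤ (1 + δ) * (dobinskiTerm n (i + 2) * dobinskiTerm n i) := by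
  refine sq_dobinskiTerm_succ_le hδ1 (le_of_sq_le_sq ?_ (by positivity)) hi
  calc (4 : ℝ) ^ 2 ≤ δ * (4 * n) := by linarith
    _ ≤ δ * (δ * (i + 1) ^ 2) := by gcongr
    _ = (δ * (i + 1)) ^ 2 := by ring

/-- Log-concavity up to the factor `1 + δ` holds once `4 n ≤ δ j ^ 2`; for smaller `j` the terms
already grow by the factor `1 / δ`. -/
theorem sq_dobinskiTerm_le_mul_add {n : ℕ} {δ : ℝ} (hδ0 : 0 < δ) (hδ1 : δ ≤ 1)
    (hn : 3072 ≤ δ ^ 3 * n) (j : ℕ) :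
    dobinskiTerm n j ^ 2 ≤ dobinskiTerm n (j + 1) *
      ((1 + δ) * dobinskiTerm n (j - 1) + δ * dobinskiTerm n j) := by
  obtain _ | i := j
  · have hn0 : n ≠ 0 := by
      rintro rfl
      norm_num at hn
    simp [dobinskiTerm_zero_right hn0]
  rw [Nat.add_sub_cancel]
  have hpos (k : ℕ) : 0 ≤ dobinskiTerm n k := by
    unfold dobinskiTerm
    positivity
  obtain hlarge | hsmall := le_or_gt (4 * n : ℝ) (δ * (i + 1) ^ 2)
  · have hδn : 4 ≤ δ * n := by
      have : δ ^ 3 * n ≤ δ * n := by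
        gcongr
        exact pow_le_of_le_one hδ0.le hδ1 three_ne_zero
      linarith
    calc dobinskiTerm n (i + 1) ^ 2
        ≤ (1 + δ) * (dobinskiTerm n (i + 2) * dobinskiTerm n i) :=
          sq_dobinskiTerm_succ_le_of_le_mul_sq hδ0 hδ1 hδn hlarge
      _ ≤ (1 + δ) * (dobinskiTerm n (i + 2) * dobinskiTerm n i) +
          δ * dobinskiTerm n (i + 1) * dobinskiTerm n (i + 2) :=
        le_add_of_nonneg_right (mul_nonneg (mul_nonneg hδ0.le (hpos _)) (hpos _))
      _ = _ := by ring
  · calc dobinskiTerm n (i + 1) ^ 2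
        ≤ dobinskiTerm n (i + 1) * (δ * dobinskiTerm n (i + 2)) := by
          rw [pow_two]
          exact mul_le_mul_of_nonneg_left
            (dobinskiTerm_succ_le_mul_of_mul_sq_le hδ0 hn hsmall.le) (hpos _)
      _ ≤ dobinskiTerm n (i + 1) * (δ * dobinskiTerm n (i + 2)) +
          (1 + δ) * (dobinskiTerm n (i + 2) * dobinskiTerm n i) :=
        le_add_of_nonneg_right (mul_nonneg (by positivity) (mul_nonneg (hpos _) (hpos _)))
      _ = _ := by ring

theorem one_div_two_mul_le_variance_numBlockPairs {n : ℕ} {δ : ℝ} (hδ0 : 0 < δ) (hδ1 : δ ≤ 1)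
    (hn : 3072 ≤ δ ^ 3 * n) :
    1 / (2 * δ) ≤ Var[numBlockPairs n; unifBPartitionNoZero n] + 1 / 2 := by
  have hn0 : n ≠ 0 := by
    rintro rfl
    norm_num at hn
  have h₁ : HasSum (fun j : ℕ => (j : ℝ) * dobinskiTerm n j)
      (Fintype.card (BPartitionNoZero (n + 1)) * Real.exp (1 / 2) / 2) := by
    convert! (hasSum_dobinskiTerm (n + 1)).div_const 2 using 2 with j
    rw [dobinskiTerm_succ_left]
    ring
  have h₂ : HasSum (fun j : ℕ => (j : ℝ) ^ 2 * dobinskiTerm n j)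
      (Fintype.card (BPartitionNoZero (n + 2)) * Real.exp (1 / 2) / 4) := by
    convert! (hasSum_dobinskiTerm (n + 2)).div_const 4 using 2 with j
    rw [dobinskiTerm_succ_left, dobinskiTerm_succ_left]
    ring
  refine (one_div_two_mul_le_variance_of_sq_le hδ0 (dobinskiTerm_zero_right hn0)
    (dobinskiTerm_succ_right_pos n) (sq_dobinskiTerm_le_mul_add hδ0 hδ1 hn)
    (hasSum_dobinskiTerm n) h₁ h₂).trans_eq ?_
  have hvar := four_mul_variance_numBlockPairs_add_two n
  have hcard : (Fintype.card (BPartitionNoZero n) : ℝ) ≠ 0 := by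
    exact_mod_cast Fintype.card_ne_zero
  field_simp at hvar ⊢
  linarith

theorem tendsto_variance_numBlockPairs :
    Tendsto (fun n => Var[numBlockPairs n; unifBPartitionNoZero n]) atTop atTop := by
  refine tendsto_atTop.2 fun b => ?_
  set δ := 1 / (2 * |b| + 1) with hδ
  have hδ0 : 0 < δ := by positivity
  have hδ1 : δ ≤ 1 := div_le_one_of_le₀ (by linarith [abs_nonneg b]) (by positivity)
  filter_upwards [(tendsto_natCast_atTop_atTop.const_mul_atTop (pow_pos hδ0 3)).eventually_ge_atTop
    3072] with n hn
  have hvar := one_div_two_mul_le_variance_numBlockPairs hδ0 hδ1 hn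
  have hb : 1 / (2 * δ) = |b| + 1 / 2 := by
    rw [hδ]
    field_simp
  linarith [le_abs_self b]

end VarianceGrowth

theorem mainTheorem5 :
    TendstoInDistribution
      (fun (n : ℕ) (π : BPartitionNoZero n) =>
        (numBlockPairs n π - ∫ ρ, numBlockPairs n ρ ∂(unifBPartitionNoZero n)) /
          √(variance (numBlockPairs n) (unifBPartitionNoZero n)))
      atTop (id : ℝ → ℝ) (fun n => unifBPartitionNoZero n) (gaussianReal 0 1) :=
  tendstoInDistribution_standardized_of_splits_genPoly splits_genPoly_blockPairs
    tendsto_variance_numBlockPairs
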